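/- Let $n\ge 0$. A box-ball system has balls labelled $1,\dots,n$ and boxes indexed by the natural numbers; a state is an injective map from balls to boxes. A box-ball move lets each ball once, beginning with the smallest, jump to the nearest empty box to its right. A permutation $w\in S_n$ gives the initial state in which its one-line notation is written in $n$ consecutive boxes. The increasing runs of a state are the maximal strings of balls in consecutive boxes whose labels increase from left to right. A state is steady if all its increasing runs (in their left-to-right order) are preserved by all subsequent moves and their sizes weakly decrease from right to left; the runs are then called solitons. The soliton decomposition $\mathrm{SD}(w)$ is the tableau whose rows, from top to bottom, are the solitons, from right to left, of a steady state reached from $w$. Its shape $\mathrm{sh}\,\mathrm{SD}(w)$ is the sequence of row lengths. For $x<y<z$, two permutations differ by a $K_1$ move if one is obtained from the other by replacing consecutive entries $yxz$ by $yzx$ or vice versa, and by a $K_2$ move if one is obtained from the other by replacing consecutive entries $xzy$ by $zxy$ or vice versa. A Knuth move is a $K_1$ or a $K_2$ move, and it is a $K_B$ move if the two permutations differ both by a $K_1$ move and by a $K_2$ move. **Theorem.** Let $\pi,w\in S_n$. Both box-ball systems reach a steady state after finitely many moves (so $\mathrm{SD}(\pi)$ and $\mathrm{SD}(w)$ are defined),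 and: 1. If $\pi$ and $w$ are related by a finite sequence of Knuth moves containing an odd number of $K_B$ moves, then $\mathrm{SD}(\pi)\neq \mathrm{SD}(w)$. 2. If $\pi$ and $w$ are related by a finite sequence of Knuth moves none of which is a $K_B$ move, then $\mathrm{sh}\,\mathrm{SD}(\pi)=\mathrm{sh}\,\mathrm{SD}(w)$. -/

import Mathlib

namespace BoxBall

/-! ### Box-ball systems

Balls are labelled by `Fin n` (that is, `0, …, n - 1` in place of `1, …, n`), and boxes by `ℕ`. -/

/-- A state of a box-ball system: ball `b` lies in box `s b`, at most one ball in each box. -/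
abbrev State (n : ℕ) := Fin n ↪ ℕ

theorem exists_emptyBox {n : ℕ} (s : State n) (b : Fin n) :
    ∃ k : ℕ, s b < k ∧ ∀ c : Fin n, s c ≠ k := by
  obtain ⟨M, hM⟩ := (Set.finite_range s).bddAbove
  refine ⟨M + 1, Nat.lt_succ_of_le (hM ⟨b, rfl⟩), fun c hc => ?_⟩
  have : s c ≤ M := hM ⟨c, rfl⟩
  omega

/-- The nearest empty box to the right of ball `b`. -/
def nearestEmpty {n : ℕ} (s : State n) (b : Fin n) : ℕ :=
  Nat.find (exists_emptyBox s b)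

/-- Ball `b` jumps to the nearest empty box to its right. -/
def moveBall {n : ℕ} (s : State n) (b : Fin n) : State n where
  toFun := Function.update s b (nearestEmpty s b)
  inj' := by
    have h := (Nat.find_spec (exists_emptyBox s b)).2
    intro c d hcd
    by_cases hc : c = b <;> by_cases hd : d = b
    · rw [hc, hd]
    · subst hc
      rw [Function.update_self, Function.update_of_ne hd] at hcd
      exact absurd hcd.symm (h d)
    · subst hd
      rw [Function.update_self, Function.update_of_ne hc] at hcd
      exact absurd hcd (h c)
    · rw [Function.update_of_ne hc, Function.update_of_ne hd] at hcd
      exact s.injective hcd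

/-- One box-ball move: every ball, beginning with the smallest, jumps once. -/
def move {n : ℕ} (s : State n) : State n :=
  (List.finRange n).foldl moveBall s

/-- The state given by the one-line notation `w 0, w 1, …, w (n - 1)`, placed in the
boxes `0, 1, …, n - 1`. -/
def ofPerm {n : ℕ} (w : Equiv.Perm (Fin n)) : State n :=
  w.symm.toEmbedding.trans Fin.valEmbedding

/-- The balls, listed from left to right. -/
def ballsInOrder {n : ℕ} (s : State n) : List (Fin n) :=
  (List.finRange n).mergeSort (fun a b => decide (s a ≤ s b))

/-- The increasing runs of a state, listed from left to right: the maximal strings of balls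
which lie in consecutive boxes and increase from left to right. -/
def runs {n : ℕ} (s : State n) : List (List (Fin n)) :=
  (ballsInOrder s).splitBy (fun a b => decide (s b = s a + 1 ∧ a < b))

/-- A state is steady if its increasing runs are preserved (together with their left-to-right
order) by all subsequent moves, so that they are solitons, and if the sizes of these solitons
weakly decrease from right to left. -/
def IsSteady {n : ℕ} (s : State n) : Prop :=
  (∀ t : ℕ, runs (move^[t] s) = runs s) ∧
    ((runs s).map List.length).Pairwise (· ≤ ·)

/-- The box-ball system that contains `w` reaches a steady state after finitely many moves. -/
def ReachesSteadyState {n : ℕ} (w : Equiv.Perm (Fin n)) : Prop :=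
  ∃ t : ℕ, IsSteady (move^[t] (ofPerm w))

open Classical in
/-- The soliton decomposition `SD(w)`, a tableau given by the list of its rows from top to bottom:
the solitons of a steady state (here the first one that is reached), from right to left. -/
noncomputable def SD {n : ℕ} (w : Equiv.Perm (Fin n)) : List (List (Fin n)) :=
  if h : ReachesSteadyState w then (runs (move^[Nat.find h] (ofPerm w))).reverse else []

/-- Every steady state of the system gives the same soliton decomposition. -/
theorem SD_eq {n : ℕ} (w : Equiv.Perm (Fin n)) (t : ℕ)
    (ht : IsSteady (move^[t] (ofPerm w))) :
    SD w = (runs (move^[t] (ofPerm w))).reverse := by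
  classical
  have h : ReachesSteadyState w := ⟨t, ht⟩
  have hle : Nat.find h ≤ t := Nat.find_min' h ht
  have hs := (Nat.find_spec h).1 (t - Nat.find h)
  rw [← Function.iterate_add_apply, Nat.sub_add_cancel hle] at hs
  rw [SD, dif_pos h, hs]

/-- The shape of a tableau given by its rows: the list of the row lengths. -/
def shape {α : Type*} (T : List (List α)) : List ℕ := T.map List.length

/-! ### Knuth moves -/

/-- `w` arises from `π` by replacing consecutive entries `y x z` by `y z x`, where `x < y < z`. -/
def KnuthOnePlus {n : ℕ} (π w : Equiv.Perm (Fin n)) : Prop :=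
  ∃ i j k : Fin n, (j : ℕ) = i + 1 ∧ (k : ℕ) = j + 1 ∧
    π j < π i ∧ π i < π k ∧ w = π * Equiv.swap j k

/-- `w` arises from `π` by replacing consecutive entries `x z y` by `z x y`, where `x < y < z`. -/
def KnuthTwoPlus {n : ℕ} (π w : Equiv.Perm (Fin n)) : Prop :=
  ∃ i j k : Fin n, (j : ℕ) = i + 1 ∧ (k : ℕ) = j + 1 ∧
    π i < π k ∧ π k < π j ∧ w = π * Equiv.swap i j

/-- `π` and `w` differ by a Knuth relation of the first kind. -/
def KnuthOne {n : ℕ} (π w : Equiv.Perm (Fin n)) : Prop :=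
  KnuthOnePlus π w ∨ KnuthOnePlus w π

/-- `π` and `w` differ by a Knuth relation of the second kind. -/
def KnuthTwo {n : ℕ} (π w : Equiv.Perm (Fin n)) : Prop :=
  KnuthTwoPlus π w ∨ KnuthTwoPlus w π

/-- `π` and `w` differ by a Knuth relation of both kinds (a `K_B` move). -/
def KnuthBoth {n : ℕ} (π w : Equiv.Perm (Fin n)) : Prop :=
  KnuthOne π w ∧ KnuthTwo π w

/-- `π` and `w` differ by a Knuth move. -/
def KnuthMove {n : ℕ} (π w : Equiv.Perm (Fin n)) : Prop :=
  KnuthOne π w ∨ KnuthTwo π w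

/-- `KnuthPath π w m`: some finite sequence of Knuth moves from `π` to `w` contains
exactly `m` moves that are `K_B` moves. -/
inductive KnuthPath {n : ℕ} (π : Equiv.Perm (Fin n)) : Equiv.Perm (Fin n) → ℕ → Prop
  | refl : KnuthPath π π 0
  | both {ρ w : Equiv.Perm (Fin n)} {m : ℕ} :
      KnuthPath π ρ m → KnuthBoth ρ w → KnuthPath π w (m + 1)
  | proper {ρ w : Equiv.Perm (Fin n)} {m : ℕ} :
      KnuthPath π ρ m → KnuthMove ρ w → ¬ KnuthBoth ρ w → KnuthPath π w m

end BoxBall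

namespace BoxBall

/-! Two facts carry the proof.

First, the number of increasing runs is invariant under moves. Order the balls cyclically, so that
those which have already jumped count as the largest. The ball `b` is then smallest before its jump
and largest after it, and the jump merely replaces one run start by the box to its right
(`starts_moveBall`). Hence `SD w` has as many rows as `w` has increasing runs (`length_SD`).
Exchanging an adjacent ascent creates one run, and each kind of Knuth relation that the exchange
realises cancels one (`card_starts_swap`). So a `K_B` move changes the number of rows by one, any
other Knuth move preserves it, and the first claim follows by parity.

Second, if two states with equally many runs differ by an exchange of two adjacent boxes, so do
their successors (`AdjacentSwap.move`). After a Knuth move that is not `K_B`, every ball therefore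
stays forever within one box of its counterpart, and has the same asymptotic speed in both systems.
The speed of a ball is the size of its soliton, so the speeds determine the shape.

Steady states exist because the set of balls in the last run can only grow. Once it is constant,
this run advances by its size at each move and the other balls move as if it were absent, which
permits an induction on the set of balls (`exists_isRuns_forall_ge`). -/

variable {n : ℕ}

/-! ### Single jumps and the conservation of the number of runs -/

theorem lt_nearestEmpty (s : State n) (b : Fin n) : s b < nearestEmpty s b :=
  (Nat.find_spec (exists_emptyBox s b)).1

theorem ne_nearestEmpty (s : State n) (b c : Fin n) : s c ≠ nearestEmpty s b :=
  (Nat.find_spec (exists_emptyBox s b)).2 c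

theorem exists_ball_of_lt_nearestEmpty (s : State n) (b : Fin n) {k : ℕ} (h₁ : s b < k)
    (h₂ : k < nearestEmpty s b) : ∃ c, s c = k := by
  have := Nat.find_min (exists_emptyBox s b) h₂
  push Not at this
  exact this h₁

theorem nearestEmpty_eq_of {s : State n} {b : Fin n} {k : ℕ} (h₁ : s b < k)
    (h₂ : ∀ c, s c ≠ k) (h₃ : ∀ j, s b < j → j < k → ∃ c, s c = j) : nearestEmpty s b = k := by
  refine le_antisymm (Nat.find_min' _ ⟨h₁, h₂⟩) ?_
  by_contra! h
  obtain ⟨c, hc⟩ := h₃ _ (lt_nearestEmpty s b) h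
  exact ne_nearestEmpty s b c hc

theorem moveBall_self (s : State n) (b : Fin n) : moveBall s b b = nearestEmpty s b :=
  Function.update_self ..

theorem moveBall_of_ne (s : State n) {b c : Fin n} (h : c ≠ b) : moveBall s b c = s c :=
  Function.update_of_ne h ..

/-- An induction principle for pairs of states which are moved simultaneously, ball by ball. -/
theorem move_induction (Q : ℕ → State n → State n → Prop)
    (hQ : ∀ (b : Fin n) (s s' : State n), Q b s s' → Q (b + 1) (moveBall s b) (moveBall s' b))
    {s s' : State n} (h : Q 0 s s') : Q n (move s) (move s') := by
  have key : ∀ k ≤ n, Q k (((List.finRange n).take k).foldl moveBall s)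
      (((List.finRange n).take k).foldl moveBall s') := by
    intro k
    induction k with
    | zero => intro _; simpa using h
    | succ k ih =>
      intro hk
      have hk' : k < (List.finRange n).length := by simpa using hk
      rw [List.take_succ_eq_append_getElem hk', List.foldl_append, List.foldl_append]
      have := hQ ⟨k, hk⟩ _ _ (ih (by omega))
      simpa using this
  have := key n le_rfl
  rwa [List.take_of_length_le (by simp)] at this

/-- The rank of a ball in the cyclically shifted order in which the balls `0, …, k - 1`, which have
already jumped, come last. -/
def cyc (k : ℕ) (b : Fin n) : ℕ := if (b : ℕ) < k then b + n else b

/-- The boxes in which an increasing run starts, with respect to the cyclically shifted order. -/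
def starts (k : ℕ) (s : State n) : Finset ℕ :=
  (Finset.univ.filter fun b => ∀ c, s c + 1 = s b → cyc k b < cyc k c).map s

theorem mem_starts {k : ℕ} {s : State n} {p : ℕ} :
    p ∈ starts k s ↔ ∃ b, s b = p ∧ ∀ c, s c + 1 = p → cyc k b < cyc k c := by
  simp only [starts, Finset.mem_map, Finset.mem_filter, Finset.mem_univ, true_and]
  constructor
  · rintro ⟨b, hb, rfl⟩
    exact ⟨b, rfl, hb⟩
  · rintro ⟨b, rfl, hb⟩
    exact ⟨b, hb, rfl⟩

theorem cyc_self_lt {b c : Fin n} (h : c ≠ b) : cyc b b < cyc b c := by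
  have := b.2
  have := Fin.val_ne_of_ne h
  unfold cyc
  split_ifs <;> omega

theorem cyc_succ_lt_self {b c : Fin n} (h : c ≠ b) : cyc (b + 1) c < cyc (b + 1) b := by
  have := c.2
  have := Fin.val_ne_of_ne h
  unfold cyc
  split_ifs <;> omega

theorem cyc_succ_of_ne {b c : Fin n} (h : c ≠ b) : cyc (b + 1) c = cyc b c := by
  have := Fin.val_ne_of_ne h
  unfold cyc
  split_ifs <;> omega

theorem cyc_zero (b : Fin n) : cyc 0 b = b := by simp [cyc]

theorem cyc_card (b : Fin n) : cyc n b = b + n := by simp [cyc]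

/-- Once all balls have jumped, every rank has grown by `n`, so the order is the original one. -/
theorem starts_card_eq (s : State n) : starts n s = starts 0 s := by
  ext p
  simp [mem_starts, cyc_zero, cyc_card]

/-- The vacated box turns the box on its right, which is occupied after the jump, into a start.
Elsewhere nothing changes: a landing box further right has a smaller ball on its left, because `b`
is now the largest; and a ball just right of the landing box starts a run behind `b` as it did
behind the empty box. -/
theorem starts_moveBall (s : State n) (b : Fin n) :
    starts (b + 1) (moveBall s b) = insert (s b + 1) ((starts b s).erase (s b)) := by
  have h₁ := lt_nearestEmpty s b
  have h₂ := ne_nearestEmpty s b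
  have h₃ := fun k => exists_ball_of_lt_nearestEmpty s b (k := k)
  have hb := moveBall_self s b
  have hc := fun c (h : c ≠ b) => moveBall_of_ne s h
  have noball : ∀ c, moveBall s b c ≠ s b := by
    intro c h
    by_cases hcb : c = b
    · subst hcb; omega
    · rw [hc c hcb] at h; exact hcb (s.injective h)
  ext p
  rw [Finset.mem_insert, Finset.mem_erase, mem_starts, mem_starts]
  by_cases hp : p = s b + 1
  · simp only [hp, true_or, iff_true]
    by_cases hq : nearestEmpty s b = s b + 1
    · exact ⟨b, by omega, fun c h => absurd (by omega) (noball c)⟩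
    · obtain ⟨c, hcs⟩ := h₃ (s b + 1) (by omega) (by omega)
      refine ⟨c, ?_, fun d h => absurd (by omega) (noball d)⟩
      rw [hc c (by rintro rfl; omega), hcs]
  by_cases hp' : p = s b
  · simp only [hp', ne_eq, not_true_eq_false, false_and, or_false]
    exact ⟨fun ⟨d, hd, _⟩ => absurd hd (noball d), fun h => by omega⟩
  simp only [hp, hp', false_or, ne_eq, not_false_eq_true, true_and]
  constructor
  · rintro ⟨d, hd, hds⟩
    have hdb : d ≠ b := by
      rintro rfl
      obtain ⟨c, hcs⟩ := h₃ (p - 1) (by omega) (by omega)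
      have hcd : c ≠ d := by rintro rfl; omega
      have := hds c (by rw [hc c hcd]; omega)
      have := cyc_succ_lt_self hcd
      omega
    refine ⟨d, by rw [← hd, hc d hdb], fun c h => ?_⟩
    have hcb : c ≠ b := by rintro rfl; omega
    rw [← cyc_succ_of_ne hdb, ← cyc_succ_of_ne hcb]
    exact hds c (by rw [hc c hcb, h])
  · rintro ⟨d, hd, hds⟩
    have hdb : d ≠ b := by rintro rfl; omega
    refine ⟨d, by rw [hc d hdb, hd], fun c h => ?_⟩
    by_cases hcb : c = b
    · subst hcb; exact cyc_succ_lt_self hdb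
    · rw [cyc_succ_of_ne hdb, cyc_succ_of_ne hcb]
      exact hds c (by rw [← hc c hcb, h])

theorem card_starts_moveBall (s : State n) (b : Fin n) :
    (starts (b + 1) (moveBall s b)).card = (starts b s).card := by
  have h₁ : s b ∈ starts b s :=
    mem_starts.2 ⟨b, rfl, fun c h => cyc_self_lt (by rintro rfl; omega)⟩
  have h₂ : s b + 1 ∉ (starts b s).erase (s b) := by
    rw [Finset.mem_erase, mem_starts]
    rintro ⟨-, c, hc, h⟩
    have := h b rfl
    have := cyc_self_lt (b := b) (c := c) (by rintro rfl; omega)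
    omega
  rw [starts_moveBall, Finset.card_insert_of_notMem h₂, Finset.card_erase_add_one h₁]

theorem card_starts_move (s : State n) : (starts 0 (move s)).card = (starts 0 s).card := by
  rw [← starts_card_eq (move s)]
  exact move_induction (fun k u _ => (starts k u).card = (starts 0 s).card)
    (fun b u _ h => (card_starts_moveBall u b).trans h) (s' := s) rfl

theorem card_starts_iterate_move (s : State n) (t : ℕ) :
    (starts 0 (move^[t] s)).card = (starts 0 s).card := by
  induction t with
  | zero => rfl
  | succ t ih => rw [Function.iterate_succ_apply', card_starts_move, ih]

/-! ### Exchanging the contents of two adjacent boxes -/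

/-- The states differ by an exchange of the contents of two adjacent boxes. -/
def AdjacentSwap (s s' : State n) : Prop :=
  ∃ p, ∀ b, s' b = Equiv.swap p (p + 1) (s b)

theorem AdjacentSwap.symm {s s' : State n} (h : AdjacentSwap s s') : AdjacentSwap s' s := by
  obtain ⟨p, hp⟩ := h
  exact ⟨p, fun b => by rw [hp, Equiv.swap_apply_self]⟩

theorem AdjacentSwap.le_add_one {s s' : State n} (h : AdjacentSwap s s') (b : Fin n) :
    s b ≤ s' b + 1 ∧ s' b ≤ s b + 1 := by
  obtain ⟨p, hp⟩ := h
  rw [hp, Equiv.swap_apply_def]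
  split_ifs <;> omega

theorem AdjacentSwap.of_nearestEmpty {s s' : State n} {p : ℕ}
    (hp : ∀ b, s' b = Equiv.swap p (p + 1) (s b)) {b : Fin n}
    (hb : nearestEmpty s' b = Equiv.swap p (p + 1) (nearestEmpty s b)) :
    AdjacentSwap (moveBall s b) (moveBall s' b) := by
  refine ⟨p, fun c => ?_⟩
  by_cases hc : c = b
  · subst hc; rw [moveBall_self, moveBall_self, hb]
  · rw [moveBall_of_ne _ hc, moveBall_of_ne _ hc, hp]

/-- If the smallest ball `b` and an empty box to its right are exchanged without a change of the
number of runs, then the next box is empty as well. -/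
theorem empty_of_card_starts_eq {s s' : State n} {b : Fin n}
    (hp : ∀ c, s' c = Equiv.swap (s b) (s b + 1) (s c)) (he : ∀ c, s c ≠ s b + 1)
    (hs : (starts b s).card = (starts b s').card) (c : Fin n) : s c ≠ s b + 2 := by
  intro hc
  have hb' : s' b = s b + 1 := by rw [hp, Equiv.swap_apply_left]
  have hne : ∀ d, d ≠ b → s' d = s d := fun d hd => by
    rw [hp, Equiv.swap_apply_of_ne_of_ne (fun h => hd (s.injective h)) (he d)]
  have hcb : c ≠ b := by rintro rfl; omega
  -- The start `s b + 1` of `s'` corresponds to the start `s b` of `s`. A ball in box `s b + 2`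
  -- starts a run in `s`, behind an empty box, but not in `s'`, behind the smallest ball; so `s`
  -- would have one run more.
  have key : insert (s b + 2) (insert (s b) ((starts b s').erase (s b + 1))) = starts b s := by
    ext p
    simp only [Finset.mem_insert, Finset.mem_erase, mem_starts]
    by_cases h2 : p = s b + 2
    · simp only [h2, true_or, true_iff]
      exact ⟨c, hc, fun d hd => absurd (by omega) (he d)⟩
    by_cases h0 : p = s b
    · simp only [h0, true_or, or_true, true_iff]
      exact ⟨b, rfl, fun d hd => cyc_self_lt (by rintro rfl; omega)⟩
    by_cases h1 : p = s b + 1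
    · simp only [h1, ne_eq, not_true_eq_false, false_and, or_false]
      constructor
      · rintro (h | h) <;> omega
      · rintro ⟨d, hd, -⟩
        exact absurd hd (he d)
    simp only [h2, h0, h1, false_or, ne_eq, not_false_eq_true, true_and]
    refine exists_congr fun d => ?_
    have e1 : s' d = p ↔ s d = p := by
      by_cases hd : d = b
      · subst hd; omega
      · rw [hne d hd]
    rw [e1]
    refine and_congr_right fun _ => forall_congr' fun e => ?_
    have e2 : s' e + 1 = p ↔ s e + 1 = p := by
      by_cases hd : e = b
      · subst hd; omega
      · rw [hne e hd]
    rw [e2]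
  have n1 : s b + 1 ∈ starts b s' :=
    mem_starts.2 ⟨b, hb', fun d hd => cyc_self_lt (by rintro rfl; omega)⟩
  have n2 : s b ∉ starts b s' := by
    rw [mem_starts]
    rintro ⟨d, hd, -⟩
    by_cases hdb : d = b
    · subst hdb; omega
    · rw [hne d hdb] at hd; exact hdb (s.injective hd)
  have n3 : s b + 2 ∉ starts b s' := by
    rw [mem_starts]
    rintro ⟨d, hd, h⟩
    have := h b (by omega)
    have := cyc_self_lt (b := b) (c := d) (by rintro rfl; omega)
    omega
  rw [← key, Finset.card_insert_of_notMem (by simp [n3]), Finset.card_insert_of_notMem (by simp [n2]),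
    Finset.card_erase_add_one n1] at hs
  omega

/-- The exchanged pair of boxes shifts by one: `b` lands in `s b + 1` and in `s b + 2`,
respectively. -/
theorem AdjacentSwap.moveBall_of_empty {s s' : State n} {b : Fin n}
    (hp : ∀ c, s' c = Equiv.swap (s b) (s b + 1) (s c)) (he : ∀ c, s c ≠ s b + 1)
    (hs : (starts b s).card = (starts b s').card) :
    AdjacentSwap (moveBall s b) (moveBall s' b) := by
  have h2 := empty_of_card_starts_eq hp he hs
  have hb' : s' b = s b + 1 := by rw [hp, Equiv.swap_apply_left]
  have hne : ∀ d, d ≠ b → s' d = s d := fun d hd => by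
    rw [hp, Equiv.swap_apply_of_ne_of_ne (fun h => hd (s.injective h)) (he d)]
  have q : nearestEmpty s b = s b + 1 := nearestEmpty_eq_of (by omega) he (by omega)
  have q' : nearestEmpty s' b = s b + 2 := by
    refine nearestEmpty_eq_of (by omega) (fun c => ?_) (by omega)
    by_cases hc : c = b
    · subst hc; omega
    · rw [hne c hc]; exact h2 c
  refine ⟨s b + 1, fun c => ?_⟩
  by_cases hc : c = b
  · subst hc
    rw [moveBall_self, moveBall_self, q, q', Equiv.swap_apply_left]
  · rw [moveBall_of_ne _ hc, moveBall_of_ne _ hc, hne c hc,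
      Equiv.swap_apply_of_ne_of_ne (he c) (h2 c)]

/-- The count of runs matters only if `b` lies in one box of the pair and the other is empty. If the
other is occupied, `b` jumps to the same box in both states. If `b` lies outside the pair, the
exchange maps one target to the other. -/
theorem AdjacentSwap.moveBall {s s' : State n} (h : AdjacentSwap s s') {b : Fin n}
    (hs : (starts b s).card = (starts b s').card) :
    AdjacentSwap (moveBall s b) (moveBall s' b) := by
  obtain ⟨p, hp⟩ := h
  have hp' : ∀ c, s c = Equiv.swap p (p + 1) (s' c) := fun c => by
    rw [hp, Equiv.swap_apply_self]
  by_cases hempty : (∀ c, s c ≠ p) ∧ ∀ c, s c ≠ p + 1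
  · have : s' = s := by
      ext c
      rw [hp, Equiv.swap_apply_of_ne_of_ne (hempty.1 c) (hempty.2 c)]
    subst this
    -- The two states are equal, so any pair of empty boxes serves; the sum of all positions bounds
    -- each of them.
    refine ⟨∑ c, BoxBall.moveBall s' b c + 1, fun c => ?_⟩
    have : BoxBall.moveBall s' b c ≤ ∑ c, BoxBall.moveBall s' b c :=
      Finset.single_le_sum (fun _ _ => Nat.zero_le _) (Finset.mem_univ c)
    rw [Equiv.swap_apply_of_ne_of_ne] <;> omega
  have h₁ := lt_nearestEmpty s b
  have h₂ := ne_nearestEmpty s b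
  have h₃ := fun k => exists_ball_of_lt_nearestEmpty s b (k := k)
  by_cases hb : s b = p
  · subst hb
    by_cases he : ∀ c, s c ≠ s b + 1
    · exact AdjacentSwap.moveBall_of_empty hp he hs
    push Not at he
    obtain ⟨c, hc⟩ := he
    apply AdjacentSwap.of_nearestEmpty hp
    have hq : nearestEmpty s b ≠ s b + 1 := fun h => h₂ c (by omega)
    have hb' : s' b = s b + 1 := by rw [hp, Equiv.swap_apply_left]
    rw [Equiv.swap_apply_of_ne_of_ne (by omega) hq]
    refine nearestEmpty_eq_of (by omega) (fun d => ?_) (fun j hj hj' => ?_)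
    · rw [hp]
      intro hd
      rw [Equiv.swap_apply_eq_iff, Equiv.swap_apply_of_ne_of_ne (by omega) hq] at hd
      exact h₂ d hd
    · obtain ⟨d, hd⟩ := h₃ j (by omega) hj'
      exact ⟨d, by rw [hp, hd, Equiv.swap_apply_of_ne_of_ne] <;> omega⟩
  by_cases hb1 : s b = p + 1
  · have hb' : s' b = p := by rw [hp, hb1, Equiv.swap_apply_right]
    by_cases he : ∀ c, s' c ≠ p + 1
    · subst hb'
      exact (AdjacentSwap.moveBall_of_empty hp' he hs.symm).symm
    push Not at he
    obtain ⟨c, hc⟩ := he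
    apply AdjacentSwap.of_nearestEmpty hp
    rw [Equiv.swap_apply_of_ne_of_ne (by omega) (by omega)]
    refine nearestEmpty_eq_of (by omega) (fun d => ?_) (fun j hj hj' => ?_)
    · rw [hp]
      intro hd
      rw [Equiv.swap_apply_eq_iff, Equiv.swap_apply_of_ne_of_ne (by omega) (by omega)] at hd
      exact h₂ d hd
    · by_cases hj1 : j = p + 1
      · exact ⟨c, by omega⟩
      · obtain ⟨d, hd⟩ := h₃ j (by omega) hj'
        exact ⟨d, by rw [hp, hd, Equiv.swap_apply_of_ne_of_ne] <;> omega⟩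
  apply AdjacentSwap.of_nearestEmpty hp
  have hb' : s' b = s b := by rw [hp, Equiv.swap_apply_of_ne_of_ne hb hb1]
  -- If the target in `s` is box `p`, the ball in box `p + 1` fills box `p` of `s'`, so that the
  -- target there is `p + 1`.
  have hsome : (∃ c, s c = p) ∨ ∃ c, s c = p + 1 := by
    by_contra! h; exact hempty h
  refine nearestEmpty_eq_of ?_ (fun d => ?_) (fun j hj hj' => ?_)
  · rw [Equiv.swap_apply_def]; split_ifs <;> omega
  · rw [hp]
    exact fun h => h₂ d ((Equiv.swap p (p + 1)).injective h)
  · suffices h : ∃ d, s d = Equiv.swap p (p + 1) j by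
      obtain ⟨d, hd⟩ := h
      exact ⟨d, by rw [hp, hd, Equiv.swap_apply_self]⟩
    rw [Equiv.swap_apply_def] at hj' ⊢
    split_ifs at hj' ⊢ with h5 h6 h7 h8
    all_goals first
      | omega
      | exact h₃ _ (by omega) (by omega)
      | exact hsome.resolve_left fun ⟨c, hc⟩ => h₂ c (by omega)

theorem AdjacentSwap.move {s s' : State n} (h : AdjacentSwap s s')
    (hs : (starts 0 s).card = (starts 0 s').card) : AdjacentSwap (move s) (move s') :=
  (move_induction (fun k u u' => AdjacentSwap u u' ∧ (starts k u).card = (starts k u').card)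
    (fun b u u' h => ⟨h.1.moveBall h.2, by
      rw [card_starts_moveBall, card_starts_moveBall, h.2]⟩) ⟨h, hs⟩).1

theorem AdjacentSwap.iterate_move {s s' : State n} (h : AdjacentSwap s s')
    (hs : (starts 0 s).card = (starts 0 s').card) (t : ℕ) :
    AdjacentSwap (BoxBall.move^[t] s) (BoxBall.move^[t] s') := by
  induction t with
  | zero => exact h
  | succ t ih =>
    rw [Function.iterate_succ_apply', Function.iterate_succ_apply']
    exact ih.move (by rw [card_starts_iterate_move, card_starts_iterate_move, hs])

/-! ### Reaching a steady state -/

/-- Box `k` is occupied when ball `b` jumps, in a move from `f` to `g` of the balls in `R`. -/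
def OccupiedAt (R : Finset (Fin n)) (f g : Fin n → ℕ) (b : Fin n) (k : ℕ) : Prop :=
  ∃ c ∈ R, (c < b ∧ g c = k) ∨ (b < c ∧ f c = k)

/-- The positions `g` of the balls in `R` arise from the positions `f` by a box-ball move of the
system that has only the balls in `R`. -/
def IsMove (R : Finset (Fin n)) (f g : Fin n → ℕ) : Prop :=
  ∀ b ∈ R, f b < g b ∧ ¬ OccupiedAt R f g b (g b) ∧
    ∀ k, f b < k → k < g b → OccupiedAt R f g b k

/-- `IsMove` refers only to old and new positions, so it still makes sense after the last run has
been removed. -/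
theorem isMove_move (s : State n) : IsMove Finset.univ s (move s) := by
  have key := move_induction (fun k u _ => (∀ b : Fin n, k ≤ b → u b = s b) ∧
    ∀ b : Fin n, (b : ℕ) < k → s b < u b ∧ ¬ OccupiedAt Finset.univ s u b (u b) ∧
      ∀ j, s b < j → j < u b → OccupiedAt Finset.univ s u b j) ?_ (s := s) (s' := s) ?_
  · exact fun b _ => key.2 b b.2
  · rintro b u - ⟨h₁, h₂⟩
    have hne := fun c (h : c ≠ b) => moveBall_of_ne u h
    have hocc : ∀ c ≤ b, ∀ j,
        OccupiedAt Finset.univ s (moveBall u b) c j ↔ OccupiedAt Finset.univ s u c j := by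
      intro c hc j
      simp only [OccupiedAt, Finset.mem_univ, true_and]
      refine exists_congr fun d => or_congr_left (and_congr_right fun hd => ?_)
      rw [hne d (by omega)]
    refine ⟨fun c hc => ?_, fun c hc => ?_⟩
    · rw [hne c (by rintro rfl; omega)]
      exact h₁ c (by omega)
    · have hcb : c ≤ b := by rw [Fin.le_def]; omega
      simp only [hocc c hcb]
      by_cases hcb : c = b
      · subst hcb
        have hu := h₁ c le_rfl
        rw [moveBall_self, ← hu]
        refine ⟨lt_nearestEmpty u c, ?_, fun j hj hj' => ?_⟩
        · rintro ⟨d, -, ⟨-, h⟩ | ⟨hd, h⟩⟩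
          · exact ne_nearestEmpty u c d h
          · rw [← h₁ d (by rw [Fin.lt_def] at hd; omega)] at h
            exact ne_nearestEmpty u c d h
        · obtain ⟨d, hd⟩ := exists_ball_of_lt_nearestEmpty u c hj hj'
          refine ⟨d, Finset.mem_univ _, ?_⟩
          rcases lt_trichotomy d c with h | h | h
          · exact .inl ⟨h, hd⟩
          · subst h; omega
          · exact .inr ⟨h, by rw [← h₁ d (by rw [Fin.lt_def] at h; omega), hd]⟩
      · rw [hne c hcb]
        have := Fin.val_ne_of_ne hcb
        exact h₂ c (by omega)
  · exact ⟨fun _ _ => rfl, fun b hb => absurd hb (by omega)⟩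

/-- Ball `b` belongs to the last increasing run of the balls in `R`. -/
def InLastRun (R : Finset (Fin n)) (f : Fin n → ℕ) (b : Fin n) : Prop :=
  b ∈ R ∧ (∀ c ∈ R, ∀ d ∈ R, f b ≤ f c → f c < f d → c < d) ∧
    ∀ c ∈ R, ∀ k, f b ≤ k → k ≤ f c → ∃ d ∈ R, f d = k

section

variable {R A : Finset (Fin n)} {f g : Fin n → ℕ} {b c : Fin n}

theorem InLastRun.of_le (h : InLastRun R f b) (hc : c ∈ R) (hbc : f b ≤ f c) :
    InLastRun R f c :=
  ⟨hc, fun d hd e he h₁ h₂ => h.2.1 d hd e he (hbc.trans h₁) h₂,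
    fun d hd k h₁ h₂ => h.2.2 d hd k (hbc.trans h₁) h₂⟩

theorem InLastRun.lt_of_not (h : InLastRun R f b) (hc : c ∈ R) (hc' : ¬ InLastRun R f c) :
    f c < f b := by
  by_contra! hbc
  exact hc' (h.of_le hc hbc)

theorem InLastRun.of_succ (hf : f.Injective) (h : InLastRun R f b) (hc : c ∈ R)
    (hcb : f b = f c + 1) (hlt : c < b) : InLastRun R f c := by
  refine ⟨hc, fun d hd e he h₁ h₂ => ?_, fun d hd k h₁ h₂ => ?_⟩
  · rcases h₁.eq_or_lt with h₁ | h₁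
    · obtain rfl := hf h₁
      by_cases hbe : f b = f e
      · obtain rfl := hf hbe
        exact hlt
      · exact hlt.trans (h.2.1 b h.1 e he le_rfl (by omega))
    · exact h.2.1 d hd e he (by omega) h₂
  · rcases h₁.eq_or_lt with h₁ | h₁
    · exact ⟨c, hc, h₁⟩
    · exact h.2.2 d hd k (by omega) h₂

/-- If `b` landed at or before `f c`, its landing box would hold a larger ball of the last run,
which has not jumped yet. -/
theorem InLastRun.lt_isMove (h : InLastRun R f b) (hg : IsMove R f g) (hc : c ∈ R) :
    f c < g b := by
  by_contra! hle
  obtain ⟨h₁, h₂, -⟩ := hg b h.1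
  obtain ⟨d, hd, hd'⟩ := h.2.2 c hc (g b) h₁.le hle
  exact h₂ ⟨d, hd, .inr ⟨h.2.1 b h.1 d hd le_rfl (by omega), hd'⟩⟩

/-- The balls which jump beyond all balls belong to the last increasing run afterwards. -/
theorem IsMove.inLastRun (hg : IsMove R f g) (hb : b ∈ R) (h : ∀ c ∈ R, f c < g b) :
    InLastRun R g b := by
  refine ⟨hb, fun c hc d hd h₁ h₂ => ?_, fun c hc k h₁ h₂ => ?_⟩
  -- The box `g c` lies beyond all old positions, so whatever occupies it when `d` jumps over it is
  -- a ball that has already jumped; it still blocks the box when `c` jumps.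
  · by_contra! hdc
    obtain ⟨e, he, h₃ | h₃⟩ := (hg d hd).2.2 (g c) ((h d hd).trans_le h₁) h₂
    · exact (hg c hc).2.1 ⟨e, he, .inl ⟨h₃.1.trans_le hdc, h₃.2⟩⟩
    · have := h e he
      omega
  · rcases h₂.eq_or_lt with h₂ | h₂
    · exact ⟨c, hc, h₂.symm⟩
    · obtain ⟨e, he, h₃ | h₃⟩ := (hg c hc).2.2 k ((h c hc).trans_le h₁) h₂
      · exact ⟨e, he, h₃.2⟩
      · have := h e he
        omega

theorem InLastRun.isMove (h : InLastRun R f b) (hg : IsMove R f g) : InLastRun R g b :=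
  hg.inLastRun h.1 fun _ hc => h.lt_isMove hg hc

/-- If the last run keeps its balls, then it is shifted by its size. -/
theorem IsMove.eq_add_card (hg : IsMove R f g) (hA : ∀ b, b ∈ A ↔ InLastRun R f b)
    (hA' : ∀ b, InLastRun R g b → b ∈ A) (hf : f.Injective) (hgi : g.Injective) (hb : b ∈ A) :
    g b = f b + A.card := by
  have hbl := (hA b).1 hb
  have hmono : ∀ c ∈ A, c ≤ b → f c ≤ f b := fun c hc hcb => by
    by_contra! hlt
    have := hbl.2.1 b hbl.1 c ((hA c).1 hc).1 le_rfl hlt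
    omega
  -- Just after the jump of `b`, these boxes hold exactly the last run: the balls up to `b` at their
  -- new positions, the larger ones at their old positions.
  have himage : Finset.Ioc (f b) (g b) = A.image fun c => if c ≤ b then g c else f c := by
    ext k
    simp only [Finset.mem_Ioc, Finset.mem_image]
    constructor
    · rintro ⟨h₁, h₂⟩
      by_cases hk : ∃ c ∈ R, k ≤ f c
      · obtain ⟨c, hc, hkc⟩ := hk
        obtain ⟨d, hd, rfl⟩ := hbl.2.2 c hc k h₁.le hkc
        refine ⟨d, (hA d).2 (hbl.of_le hd h₁.le), ?_⟩
        rw [if_neg (hbl.2.1 b hbl.1 d hd le_rfl h₁).not_ge]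
      · push Not at hk
        rcases h₂.eq_or_lt with rfl | h₂
        · exact ⟨b, hb, if_pos le_rfl⟩
        · obtain ⟨c, hc, h₃ | h₃⟩ := (hg b hbl.1).2.2 k h₁ h₂
          · refine ⟨c, hA' c (hg.inLastRun hc fun d hd => ?_), ?_⟩
            · rw [h₃.2]; exact hk d hd
            · rw [if_pos h₃.1.le, h₃.2]
          · have := hk c hc
            omega
    · rintro ⟨c, hc, rfl⟩
      have hcl := (hA c).1 hc
      split_ifs with hcb
      · refine ⟨hcl.lt_isMove hg hbl.1, ?_⟩
        have hbg := hbl.isMove hg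
        have hcg := hcl.isMove hg
        by_contra! hlt
        have := hbg.2.1 b hbl.1 c hcl.1 le_rfl hlt
        omega
      · refine ⟨?_, (hbl.lt_isMove hg hcl.1).le⟩
        by_contra! hle
        have hne : f c ≠ f b := fun h => hcb (hf h).le
        have := hcl.2.1 c hcl.1 b hbl.1 le_rfl (by omega)
        omega
  have hcard := congrArg Finset.card himage
  rw [Nat.card_Ioc, Finset.card_image_of_injOn] at hcard
  · have := (hg b hbl.1).1
    omega
  · intro c hc d hd hcd
    have hcl := (hA c).1 hc
    have hdl := (hA d).1 hd
    have h₁ := hcl.lt_isMove hg hdl.1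
    have h₂ := hdl.lt_isMove hg hcl.1
    simp only at hcd
    split_ifs at hcd
    · exact hgi hcd
    · omega
    · omega
    · exact hf hcd

/-- If the last run keeps its balls, then the other balls move as they would without it. -/
theorem IsMove.sdiff (hg : IsMove R f g) (hA : ∀ b, b ∈ A ↔ InLastRun R f b)
    (hA' : ∀ b, InLastRun R g b → b ∈ A) : IsMove (R \ A) f g := by
  intro b hb
  rw [Finset.mem_sdiff] at hb
  obtain ⟨h₁, h₂, h₃⟩ := hg b hb.1
  refine ⟨h₁, fun ⟨c, hc, h⟩ => h₂ ⟨c, (Finset.mem_sdiff.1 hc).1, h⟩, fun k hk hk' => ?_⟩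
  obtain ⟨c, hc, h⟩ := h₃ k hk hk'
  by_cases hcA : c ∈ A
  -- A ball of `A` cannot block `b`. As `b` does not join the last run, its target is at most some
  -- old position `f d`. A ball of `A` that has jumped lies beyond `f d`; one that has not is
  -- followed by occupied boxes up to `f d`, among them the target of `b`.
  · exfalso
    have hcl := (hA c).1 hcA
    have hle : ∃ d ∈ R, g b ≤ f d := by
      by_contra! hlt
      exact hb.2 (hA' b (hg.inLastRun hb.1 hlt))
    obtain ⟨d, hd, hle⟩ := hle
    rcases h with ⟨-, rfl⟩ | ⟨hbc, rfl⟩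
    · have := hcl.lt_isMove hg hd
      omega
    · obtain ⟨e, he, heq⟩ := hcl.2.2 d hd (g b) hk'.le hle
      exact h₂ ⟨e, he, .inr ⟨hbc.trans (hcl.2.1 c hc e he le_rfl (by omega)), heq⟩⟩
  · exact ⟨c, Finset.mem_sdiff.2 ⟨hc, hcA⟩, h⟩

end

/-- `L` lists the increasing runs of the balls in `R`, which lie at the positions `f`. -/
def IsRuns (R : Finset (Fin n)) (f : Fin n → ℕ) (L : List (List (Fin n))) : Prop :=
  (∀ b, b ∈ L.flatten ↔ b ∈ R) ∧ L.flatten.Pairwise (fun a b => f a < f b) ∧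
    L.flatten.splitBy (fun a b => decide (f b = f a + 1 ∧ a < b)) = L

theorem isChain_of_forall_exists {f : Fin n → ℕ} : ∀ {l : List (Fin n)},
    l.Pairwise (fun a b => a < b ∧ f a < f b) →
    (∀ a ∈ l, ∀ c ∈ l, ∀ k, f a ≤ k → k ≤ f c → ∃ d ∈ l, f d = k) →
    l.IsChain (fun a b => f b = f a + 1 ∧ a < b)
  | [], _, _ => .nil
  | [_], _, _ => .singleton _
  | a :: b :: l, hl, h => by
    rw [List.pairwise_cons] at hl
    have hab := hl.1 b (by simp)
    refine .cons_cons ⟨?_, hab.1⟩ (isChain_of_forall_exists hl.2 fun x hx y hy k h₁ h₂ => ?_)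
    · obtain ⟨d, hd, hda⟩ := h a (by simp) b (by simp) (f a + 1) (by omega) (by omega)
      rcases List.mem_cons.1 hd with rfl | hd
      · omega
      rcases List.mem_cons.1 hd with rfl | hd
      · exact hda
      have := (List.pairwise_cons.1 hl.2).1 d hd
      omega
    · obtain ⟨d, hd, hdk⟩ :=
        h x (List.mem_cons_of_mem _ hx) y (List.mem_cons_of_mem _ hy) k h₁ h₂
      rcases List.mem_cons.1 hd with rfl | hd
      · have := hl.1 x hx
        omega
      · exact ⟨d, hd, hdk⟩

/-- The last run does not merge with what precedes it: by `InLastRun.of_succ`, a smaller ball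
directly before its head would belong to it. -/
theorem IsRuns.append_sort {R A : Finset (Fin n)} {f : Fin n → ℕ} {L : List (List (Fin n))}
    (hL : IsRuns (R \ A) f L) (hf : f.Injective) (hA : ∀ b, b ∈ A ↔ InLastRun R f b)
    (hne : A.Nonempty) : IsRuns R f (L ++ [A.sort]) := by
  have hsub : A ⊆ R := fun b hb => ((hA b).1 hb).1
  have hlt : ∀ a ∈ L.flatten, ∀ b ∈ A, f a < f b := fun a ha b hb => by
    have := (hL.1 a).1 ha
    rw [Finset.mem_sdiff, hA] at this
    exact ((hA b).1 hb).lt_of_not this.1 this.2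
  have hsort : A.sort.Pairwise (fun a b => a < b ∧ f a < f b) := by
    refine List.Pairwise.imp_of_mem (fun {a b} ha hb hab => ⟨hab, ?_⟩) A.sortedLT_sort.pairwise
    rw [Finset.mem_sort] at ha hb
    by_contra! hle
    have hne : f b ≠ f a := fun h => hab.ne (hf h).symm
    have hbl := (hA b).1 hb
    have := hbl.2.1 b hbl.1 a (hsub ha) le_rfl (by omega)
    omega
  have hflat : (L ++ [A.sort]).flatten = L.flatten ++ A.sort := by simp
  refine ⟨fun b => ?_, ?_, ?_⟩
  · rw [hflat, List.mem_append, hL.1, Finset.mem_sort, Finset.mem_sdiff]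
    have := @hsub b
    tauto
  · rw [hflat, List.pairwise_append]
    refine ⟨hL.2.1, hsort.imp And.right, fun a ha b hb => hlt a ha b (by simpa using hb)⟩
  · rw [hflat, List.splitBy_append, hL.2.2, List.splitBy_of_isChain]
    · rw [ne_eq, ← List.length_eq_zero_iff, Finset.length_sort]
      exact hne.card_pos.ne'
    · simp only [decide_eq_true_eq]
      refine isChain_of_forall_exists hsort fun a ha c hc k h₁ h₂ => ?_
      rw [Finset.mem_sort] at ha hc
      have hal := (hA a).1 ha
      obtain ⟨d, hd, rfl⟩ := hal.2.2 c (hsub hc) k h₁ h₂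
      exact ⟨d, by rw [Finset.mem_sort, hA]; exact hal.of_le hd h₁, rfl⟩
    · intro a ha b hb
      have ha' := (hL.1 a).1 (List.mem_of_mem_getLast? ha)
      have hb' : b ∈ A := by simpa using List.mem_of_mem_head? hb
      rw [Finset.mem_sdiff, hA] at ha'
      rw [decide_eq_false_iff_not]
      rintro ⟨h₁, h₂⟩
      exact ha'.2 (((hA b).1 hb').of_succ hf ha'.1 h₁ h₂)

/-! ### Stabilisation of the last run and induction on the set of balls -/

theorem exists_inLastRun {R : Finset (Fin n)} (hR : R.Nonempty) (f : Fin n → ℕ) :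
    ∃ b, InLastRun R f b := by
  obtain ⟨b, hb, hmax⟩ := R.exists_max_image f hR
  refine ⟨b, hb, fun c hc d hd h₁ h₂ => ?_, fun c hc k h₁ h₂ => ⟨b, hb, ?_⟩⟩
  · have := hmax d hd
    omega
  · have := hmax c hc
    omega

/-- The set of balls in the last run is eventually constant. -/
theorem exists_lastRun_const {R : Finset (Fin n)} {F : ℕ → Fin n → ℕ} {T : ℕ}
    (hF : ∀ t ≥ T, IsMove R (F t) (F (t + 1))) :
    ∃ T' ≥ T, ∃ A : Finset (Fin n), ∀ t ≥ T', ∀ b, b ∈ A ↔ InLastRun R (F t) b := by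
  classical
  let B : ℕ →o Finset (Fin n) :=
    ⟨fun t => Finset.univ.filter fun b => InLastRun R (F (T + t)) b, monotone_nat_of_le_succ
      fun t b hb => by
        rw [Finset.mem_filter] at hb ⊢
        exact ⟨hb.1, hb.2.isMove (hF (T + t) (by omega))⟩⟩
  obtain ⟨N, hN⟩ := WellFoundedGT.monotone_chain_condition B
  refine ⟨T + N, by omega, B N, fun t ht b => ?_⟩
  rw [hN (t - T) (by omega)]
  simp [B, show T + (t - T) = t by omega]

theorem exists_isRuns_forall_ge {F : ℕ → Fin n → ℕ} (hinj : ∀ t, (F t).Injective) :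
    ∀ (R : Finset (Fin n)) (T : ℕ), (∀ t ≥ T, IsMove R (F t) (F (t + 1))) →
    ∃ T' ≥ T, ∃ L : List (List (Fin n)), (L.map List.length).Pairwise (· ≤ ·) ∧
      ∀ t ≥ T', IsRuns R (F t) L ∧ ∀ l ∈ L, ∀ b ∈ l, F (t + 1) b = F t b + l.length := by
  intro R
  induction R using Finset.strongInduction with
  | H R ih =>
  intro T hF
  rcases R.eq_empty_or_nonempty with rfl | hR
  · exact ⟨T, le_rfl, [], by simp, fun t _ => by simp [IsRuns]⟩
  obtain ⟨T₁, hT₁, A, hA⟩ := exists_lastRun_const hF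
  have hne : A.Nonempty := by
    obtain ⟨b, hb⟩ := exists_inLastRun hR (F T₁)
    exact ⟨b, (hA T₁ le_rfl b).2 hb⟩
  have hsub : A ⊆ R := fun b hb => ((hA T₁ le_rfl b).1 hb).1
  have hF₁ : ∀ t ≥ T₁, IsMove (R \ A) (F t) (F (t + 1)) := fun t ht =>
    (hF t (by omega)).sdiff (hA t ht) fun b hb => (hA (t + 1) (by omega) b).2 hb
  have hshift : ∀ t ≥ T₁, ∀ b ∈ A, F (t + 1) b = F t b + A.card := fun t ht b hb =>
    (hF t (by omega)).eq_add_card (hA t ht) (fun b hb => (hA (t + 1) (by omega) b).2 hb)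
      (hinj t) (hinj (t + 1)) hb
  obtain ⟨T₂, hT₂, L, hsorted, hL⟩ := ih (R \ A) (Finset.sdiff_ssubset hsub hne) T₁ hF₁
  refine ⟨T₂, by omega, L ++ [A.sort], ?_, fun t ht => ⟨?_, ?_⟩⟩
  · rw [List.map_append, List.pairwise_append]
    refine ⟨hsorted, by simp, ?_⟩
    simp only [List.map_cons, List.map_nil, List.mem_singleton, List.mem_map, Finset.length_sort]
    rintro _ ⟨l, hl, rfl⟩ _ rfl
    obtain ⟨a, ha⟩ := hne
    by_contra! hlt
    obtain ⟨b, hb⟩ := List.exists_mem_of_length_pos (l := l) (by omega)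
    have hbR := ((hL T₂ le_rfl).1.1 b).1 (List.mem_flatten.2 ⟨l, hl, hb⟩)
    have iter : ∀ j, F (T₂ + j) b = F T₂ b + j * l.length ∧
        F (T₂ + j) a = F T₂ a + j * A.card := by
      intro j
      induction j with
      | zero => simp
      | succ j ihj =>
        rw [← add_assoc, (hL (T₂ + j) (by omega)).2 l hl b hb, hshift (T₂ + j) (by omega) a ha,
          ihj.1, ihj.2]
        constructor <;> ring
    -- With a longer run, `b` gains at least one box on `a` per move, so `F T₂ a` moves suffice to
    -- catch up from any box.
    have h₁ := iter (F T₂ a)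
    rw [Finset.mem_sdiff, hA (T₂ + F T₂ a) (by omega)] at hbR
    have h₂ := ((hA (T₂ + F T₂ a) (by omega) a).1 ha).lt_of_not hbR.1 hbR.2
    have h₃ : F T₂ a * (A.card + 1) ≤ F T₂ a * l.length := Nat.mul_le_mul_left _ hlt
    rw [mul_add] at h₃
    omega
  · exact (hL t ht).1.append_sort (hinj t) (hA t (by omega)) hne
  · intro l hl b hb
    rcases List.mem_append.1 hl with hl | hl
    · exact (hL t ht).2 l hl b hb
    · obtain rfl := List.mem_singleton.1 hl
      rw [Finset.length_sort]
      exact hshift t (by omega) b (by simpa using hb)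

/-! ### From lists of runs to `runs` -/

theorem ballsInOrder_perm (s : State n) : (ballsInOrder s).Perm (List.finRange n) :=
  List.mergeSort_perm _ _

theorem ballsInOrder_pairwise (s : State n) :
    (ballsInOrder s).Pairwise fun a b => s a < s b := by
  have h₁ : (ballsInOrder s).Pairwise fun a b => decide (s a ≤ s b) = true :=
    List.pairwise_mergeSort (by simp; omega) (by simp; omega) _
  have h₂ : (ballsInOrder s).Nodup := (ballsInOrder_perm s).nodup_iff.2 (List.nodup_finRange n)
  refine (h₁.and h₂).imp fun {a b} ⟨hab, hne⟩ => ?_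
  exact lt_of_le_of_ne (of_decide_eq_true hab) fun h => hne (s.injective h)

theorem IsRuns.runs_eq {s : State n} {L : List (List (Fin n))}
    (h : IsRuns Finset.univ s L) : runs s = L := by
  have hnodup : L.flatten.Nodup := h.2.1.imp fun hab heq => by subst heq; omega
  have hperm : (ballsInOrder s).Perm L.flatten := by
    refine (ballsInOrder_perm s).trans ?_
    rw [List.perm_ext_iff_of_nodup (List.nodup_finRange n) hnodup]
    intro a
    simp [h.1]
  have : ballsInOrder s = L.flatten :=
    hperm.eq_of_pairwise (fun a b _ _ h₁ h₂ => by omega) (ballsInOrder_pairwise s) h.2.1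
  rw [runs, this, h.2.2]

/-- Eventually the runs stay the same, every ball moves with the speed given by the size of its
run, and faster runs are further to the right. -/
theorem exists_runs_forall_ge (s : State n) :
    ∃ (T : ℕ) (L : List (List (Fin n))), (L.map List.length).Pairwise (· ≤ ·) ∧
      (L.flatten.Perm (List.finRange n) ∧ [] ∉ L) ∧
      ∀ t ≥ T, runs (move^[t] s) = L ∧
        ∀ l ∈ L, ∀ b ∈ l, move^[t + 1] s b = move^[t] s b + l.length := by
  obtain ⟨T, -, L, hsorted, hL⟩ := exists_isRuns_forall_ge (F := fun t => move^[t] s)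
    (fun t => (move^[t] s).injective) Finset.univ 0 fun t _ => by
      simp only [Function.iterate_succ_apply']
      exact isMove_move _
  have hruns : ∀ t ≥ T, runs (move^[t] s) = L := fun t ht => (hL t ht).1.runs_eq
  refine ⟨T, L, hsorted, ⟨?_, ?_⟩, fun t ht => ⟨hruns t ht, (hL t ht).2⟩⟩
  · rw [← hruns T le_rfl, runs, List.flatten_splitBy]
    exact ballsInOrder_perm _
  · rw [← hruns T le_rfl]
    exact List.nil_notMem_splitBy _ _

/-! ### The number of runs -/

/-- The unfinished group `g` does not affect the count, so `splitBy` can be unfolded one element at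
a time. -/
theorem length_splitBy_loop {α : Type*} (r : α → α → Bool) (l : List α) (a : α) (g : List α)
    (gs : List (List α)) :
    (List.splitBy.loop r l a g gs).length = gs.length + ((a :: l).splitBy r).length := by
  induction l generalizing a g gs with
  | nil => simp [List.splitBy, List.splitBy.loop]
  | cons b l ih =>
    rw [List.splitBy, List.splitBy.loop, List.splitBy.loop]
    split
    · rw [ih, ih b [a] []]; simp
    · rw [ih, ih b [] _]; simp; omega

theorem length_splitBy_cons_cons {α : Type*} (r : α → α → Bool) (a b : α) (l : List α) :
    ((a :: b :: l).splitBy r).length =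
      (if r a b then 0 else 1) + ((b :: l).splitBy r).length := by
  conv_lhs => rw [List.splitBy, List.splitBy.loop]
  split <;> rename_i h <;> rw [length_splitBy_loop] <;> simp [h]

/-- As positions increase along the list, only the preceding entry can lie in the box just before a
ball; so new groups open exactly at run starts. -/
theorem length_splitBy_eq_countP (f : Fin n → ℕ) : ∀ {l : List (Fin n)},
    l.Pairwise (fun a b => f a < f b) →
    (l.splitBy fun a b => decide (f b = f a + 1 ∧ a < b)).length =
      l.countP fun b => decide (∀ c ∈ l, f c + 1 = f b → b < c)
  | [], _ => rfl
  | [a], _ => by simp [List.splitBy, List.splitBy.loop]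
  | a :: b :: l, hl => by
    rw [List.pairwise_cons] at hl
    have hbl := (List.pairwise_cons.1 hl.2).1
    have hab := hl.1 b (by simp)
    rw [length_splitBy_cons_cons, length_splitBy_eq_countP f hl.2]
    have hl' : (l.countP fun x => decide (∀ c ∈ a :: b :: l, f c + 1 = f x → x < c)) =
        l.countP fun x => decide (∀ c ∈ b :: l, f c + 1 = f x → x < c) := by
      refine List.countP_congr fun x hx => ?_
      have := hbl x hx
      simp only [decide_eq_true_eq, List.forall_mem_cons (a := a)]
      exact ⟨And.right, fun h => ⟨fun h' => by omega, h⟩⟩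
    have ha : ∀ c ∈ a :: b :: l, f c + 1 = f a → a < c := by
      intro c hc h
      rcases List.mem_cons.1 hc with rfl | hc
      · omega
      · have := hl.1 c hc
        omega
    have hb : ∀ c ∈ b :: l, f c + 1 = f b → b < c := by
      intro c hc h
      rcases List.mem_cons.1 hc with rfl | hc
      · omega
      · have := hbl c hc
        omega
    have hb' : (∀ c ∈ a :: b :: l, f c + 1 = f b → b < c) ↔ ¬ (f b = f a + 1 ∧ a < b) := by
      rw [List.forall_mem_cons]
      have hne : a ≠ b := by rintro rfl; omega
      constructor
      · rintro ⟨h, -⟩ ⟨h₁, h₂⟩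
        exact h₂.asymm (h h₁.symm)
      · refine fun h => ⟨fun h₁ => ?_, hb⟩
        by_contra! h₂
        exact h ⟨h₁.symm, lt_of_le_of_ne h₂ hne⟩
    rw [List.countP_cons, List.countP_cons, List.countP_cons, hl', decide_eq_true ha,
      decide_eq_true hb]
    by_cases h : f b = f a + 1 ∧ a < b
    · rw [decide_eq_true h, decide_eq_false fun h' => hb'.1 h' h]
      simp
    · rw [decide_eq_false h, decide_eq_true (hb'.2 h)]
      simp only [if_true, Bool.false_eq_true, if_false]
      omega

theorem length_runs (s : State n) : (runs s).length = (starts 0 s).card := by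
  rw [runs, length_splitBy_eq_countP s (ballsInOrder_pairwise s),
    (ballsInOrder_perm s).countP_eq, starts, Finset.card_map, List.countP_eq_length_filter,
    ← List.toFinset_card_of_nodup ((List.nodup_finRange n).filter _)]
  congr 1
  ext b
  simp [(ballsInOrder_perm s).mem_iff, cyc_zero]

/-! ### The change of the number of runs under an exchange -/

theorem card_eq_card_sdiff_add (S : Finset ℕ) (p : ℕ) :
    S.card = (S \ {p, p + 1, p + 2}).card + ((if p ∈ S then 1 else 0) +
      ((if p + 1 ∈ S then 1 else 0) + if p + 2 ∈ S then 1 else 0)) := by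
  rw [← Finset.card_sdiff_add_card_inter S {p, p + 1, p + 2}, Finset.inter_comm,
    ← Finset.filter_mem_eq_inter, Finset.card_filter, Finset.sum_insert (by simp),
    Finset.sum_insert (by simp), Finset.sum_singleton]

/-- The effect on the number of runs of the exchange of two adjacent balls `x < z`. -/
theorem card_starts_swap {s s' : State n} {p : ℕ} {x z : Fin n} (hx : s x = p)
    (hz : s z = p + 1) (hxz : x < z) (hs : ∀ b, s' b = Equiv.swap p (p + 1) (s b)) :
    (starts 0 s).card + 1 = (starts 0 s').card +
      (if ∃ y, s y + 1 = p ∧ x < y ∧ y < z then 1 else 0) +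
      (if ∃ y, s y = p + 2 ∧ x < y ∧ y < z then 1 else 0) := by
  have hx' : s' x = p + 1 := by rw [hs, hx, Equiv.swap_apply_left]
  have hz' : s' z = p := by rw [hs, hz, Equiv.swap_apply_right]
  have hxz' : (x : ℕ) < z := hxz
  have hne : ∀ b, b ≠ x → b ≠ z → s' b = s b := fun b h₁ h₂ => by
    rw [hs, Equiv.swap_apply_of_ne_of_ne (fun h => h₁ (s.injective (h.trans hx.symm)))
      fun h => h₂ (s.injective (h.trans hz.symm))]
  have hfar : ∀ b q, q ≠ p → q ≠ p + 1 → (s' b = q ↔ s b = q) := fun b q h₁ h₂ => by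
    by_cases hbx : b = x
    · subst hbx; omega
    by_cases hbz : b = z
    · subst hbz; omega
    rw [hne b hbx hbz]
  have hsdiff : starts 0 s' \ {p, p + 1, p + 2} = starts 0 s \ {p, p + 1, p + 2} := by
    ext q
    simp only [Finset.mem_sdiff, Finset.mem_insert, Finset.mem_singleton, not_or, mem_starts]
    refine and_congr_left fun ⟨h₀, h₁, h₂⟩ => exists_congr fun b => ?_
    rw [hfar b q h₀ h₁]
    refine and_congr_right fun _ => forall_congr' fun c => ?_
    have : s' c + 1 = q ↔ s c + 1 = q := by
      rcases q with _ | q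
      · simp
      · simpa using hfar c q (by omega) (by omega)
    rw [this]
  have e₀ : p ∈ starts 0 s ↔ ∀ y, s y + 1 = p → x < y := by
    rw [mem_starts]
    simp only [cyc_zero, Fin.val_fin_lt]
    exact ⟨fun ⟨b, hb, h⟩ => by rwa [s.injective (hb.trans hx.symm)] at h, fun h => ⟨x, hx, h⟩⟩
  have e₁ : p + 1 ∉ starts 0 s := by
    rw [mem_starts]
    rintro ⟨b, hb, h⟩
    rw [s.injective (hb.trans hz.symm)] at h
    have := h x (by omega)
    simp only [cyc_zero] at this
    omega
  have e₂ : p + 2 ∈ starts 0 s ↔ ∃ y, s y = p + 2 ∧ y < z := by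
    rw [mem_starts]
    simp only [cyc_zero, Fin.val_fin_lt]
    refine exists_congr fun b => and_congr_right fun _ => ⟨fun h => h z (by omega), fun h c hc => ?_⟩
    rwa [s.injective (a₁ := c) (a₂ := z) (by omega)]
  have e₀' : p ∈ starts 0 s' ↔ ∀ y, s y + 1 = p → z < y := by
    rw [mem_starts]
    simp only [cyc_zero, Fin.val_fin_lt]
    have : ∀ y, s' y + 1 = p ↔ s y + 1 = p := fun y => by
      rcases p with _ | p
      · simp
      · simpa using hfar y p (by omega) (by omega)
    simp only [this]
    exact ⟨fun ⟨b, hb, h⟩ => by rwa [s'.injective (hb.trans hz'.symm)] at h, fun h => ⟨z, hz', h⟩⟩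
  have e₁' : p + 1 ∈ starts 0 s' := by
    refine mem_starts.2 ⟨x, hx', fun c hc => ?_⟩
    rw [s'.injective (a₁ := c) (a₂ := z) (by omega), cyc_zero, cyc_zero]
    exact hxz
  have e₂' : p + 2 ∈ starts 0 s' ↔ ∃ y, s y = p + 2 ∧ y < x := by
    rw [mem_starts]
    simp only [cyc_zero, Fin.val_fin_lt]
    refine exists_congr fun b => ?_
    rw [hfar b _ (by omega) (by omega)]
    refine and_congr_right fun _ => ⟨fun h => h x (by omega), fun h c hc => ?_⟩
    rwa [s'.injective (a₁ := c) (a₂ := x) (by omega)]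
  -- Only `p`, `p + 1`, `p + 2` can change status. Box `p` stops being a start exactly when its left
  -- neighbour lies between `x` and `z`, and box `p + 2` exactly when its own ball does; box `p + 1`
  -- always becomes one.
  have k₀ : (if p ∈ starts 0 s then 1 else 0) = (if p ∈ starts 0 s' then 1 else 0) +
      if ∃ y, s y + 1 = p ∧ x < y ∧ y < z then 1 else 0 := by
    simp only [e₀, e₀']
    by_cases h : ∃ y, s y + 1 = p
    · obtain ⟨y, hy⟩ := h
      have hyz : y ≠ z := by rintro rfl; omega
      have hu : ∀ y', s y' + 1 = p ↔ y' = y :=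
        fun y' => ⟨fun h => s.injective (by omega), by rintro rfl; exact hy⟩
      simp only [hu, forall_eq, exists_eq_left]
      split_ifs <;> omega
    · push Not at h
      simp [h]
  have k₂ : (if p + 2 ∈ starts 0 s then 1 else 0) = (if p + 2 ∈ starts 0 s' then 1 else 0) +
      if ∃ y, s y = p + 2 ∧ x < y ∧ y < z then 1 else 0 := by
    simp only [e₂, e₂']
    by_cases h : ∃ y, s y = p + 2
    · obtain ⟨y, hy⟩ := h
      have hyx : y ≠ x := by rintro rfl; omega
      have hu : ∀ y', s y' = p + 2 ↔ y' = y :=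
        fun y' => ⟨fun h => s.injective (by omega), by rintro rfl; exact hy⟩
      simp only [hu, exists_eq_left]
      split_ifs <;> omega
    · push Not at h
      simp [h]
  rw [card_eq_card_sdiff_add (starts 0 s) p, card_eq_card_sdiff_add (starts 0 s') p, hsdiff,
    if_neg e₁, if_pos e₁', k₀, k₂]
  omega

/-! ### Knuth moves -/

theorem ofPerm_mul_swap (π : Equiv.Perm (Fin n)) {j k : Fin n} (hjk : (k : ℕ) = j + 1)
    (b : Fin n) :
    ofPerm (π * Equiv.swap j k) b = Equiv.swap (j : ℕ) (j + 1) (ofPerm π b) := by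
  have h : (π * Equiv.swap j k).symm b = Equiv.swap j k (π.symm b) := by
    rw [Equiv.symm_apply_eq]; simp
  change (((π * Equiv.swap j k).symm b : Fin n) : ℕ) = Equiv.swap (j : ℕ) (j + 1) (π.symm b : ℕ)
  rw [h, Equiv.swap_apply_def, Equiv.swap_apply_def]
  simp only [Fin.ext_iff, ← hjk]
  split_ifs <;> rfl

theorem ofPerm_apply (π : Equiv.Perm (Fin n)) (i : Fin n) : ofPerm π (π i) = i := by
  simp [ofPerm]

theorem eq_of_swap_eq_swap {j k j' k' : Fin n} (hjk : (k : ℕ) = j + 1) (hjk' : (k' : ℕ) = j' + 1)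
    (h : Equiv.swap j k = Equiv.swap j' k') : j = j' ∧ k = k' := by
  have := congrArg (fun σ : Equiv.Perm (Fin n) => σ j) h
  simp only [Equiv.swap_apply_left, Equiv.swap_apply_def j' k' j] at this
  simp only [Fin.ext_iff] at this ⊢
  split_ifs at this <;> omega

/-- Since `π` ascends from `j` to `k`, the relation can only hold in the direction from `π`. -/
theorem knuthOne_mul_swap_iff (π : Equiv.Perm (Fin n)) {j k : Fin n} (hjk : (k : ℕ) = j + 1)
    (hlt : π j < π k) : KnuthOne π (π * Equiv.swap j k) ↔
      ∃ y, ofPerm π y + 1 = j ∧ π j < y ∧ y < π k := by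
  constructor
  · rintro (⟨i, j', k', hij, hjk', h₁, h₂, h⟩ | ⟨i, j', k', hij, hjk', h₁, h₂, h⟩)
    · obtain ⟨rfl, rfl⟩ := eq_of_swap_eq_swap hjk hjk' (mul_left_cancel h)
      exact ⟨π i, by rw [ofPerm_apply, hij], h₁, h₂⟩
    · rw [mul_assoc, left_eq_mul, mul_eq_one_iff_eq_inv, Equiv.swap_inv] at h
      obtain ⟨rfl, rfl⟩ := eq_of_swap_eq_swap hjk hjk' h
      have := h₁.trans h₂
      simp only [Equiv.Perm.mul_apply, Equiv.swap_apply_left, Equiv.swap_apply_right] at this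
      exact absurd this hlt.asymm
  · rintro ⟨y, hy, h₁, h₂⟩
    obtain ⟨i, rfl⟩ := π.surjective y
    rw [ofPerm_apply] at hy
    exact .inl ⟨i, j, k, hy.symm, hjk, h₁, h₂, rfl⟩

theorem knuthTwo_mul_swap_iff (π : Equiv.Perm (Fin n)) {j k : Fin n} (hjk : (k : ℕ) = j + 1)
    (hlt : π j < π k) : KnuthTwo π (π * Equiv.swap j k) ↔
      ∃ y, ofPerm π y = j + 2 ∧ π j < y ∧ y < π k := by
  constructor
  · rintro (⟨j', k', l, hjk', hkl, h₁, h₂, h⟩ | ⟨j', k', l, hjk', hkl, h₁, h₂, h⟩)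
    · obtain ⟨rfl, rfl⟩ := eq_of_swap_eq_swap hjk hjk' (mul_left_cancel h)
      exact ⟨π l, by rw [ofPerm_apply, hkl, hjk], h₁, h₂⟩
    · rw [mul_assoc, left_eq_mul, mul_eq_one_iff_eq_inv, Equiv.swap_inv] at h
      obtain ⟨rfl, rfl⟩ := eq_of_swap_eq_swap hjk hjk' h
      have := h₁.trans h₂
      simp only [Equiv.Perm.mul_apply, Equiv.swap_apply_left, Equiv.swap_apply_right] at this
      exact absurd this hlt.asymm
  · rintro ⟨y, hy, h₁, h₂⟩
    obtain ⟨l, rfl⟩ := π.surjective y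
    rw [ofPerm_apply] at hy
    exact .inl ⟨j, k, l, hjk, by omega, h₁, h₂, rfl⟩

theorem KnuthOne.symm {π w : Equiv.Perm (Fin n)} (h : KnuthOne π w) : KnuthOne w π := Or.symm h

theorem KnuthTwo.symm {π w : Equiv.Perm (Fin n)} (h : KnuthTwo π w) : KnuthTwo w π := Or.symm h

theorem knuthBoth_comm {π w : Equiv.Perm (Fin n)} : KnuthBoth π w ↔ KnuthBoth w π :=
  ⟨fun h => ⟨h.1.symm, h.2.symm⟩, fun h => ⟨h.1.symm, h.2.symm⟩⟩

/-- Up to symmetry, a Knuth move exchanges two adjacent entries that form an ascent. -/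
theorem KnuthMove.exists_swap {π w : Equiv.Perm (Fin n)} (h : KnuthMove π w) :
    (∃ j k : Fin n, (k : ℕ) = j + 1 ∧ π j < π k ∧ w = π * Equiv.swap j k) ∨
      ∃ j k : Fin n, (k : ℕ) = j + 1 ∧ w j < w k ∧ π = w * Equiv.swap j k := by
  rcases h with (⟨i, j, k, -, hjk, h₁, h₂, h⟩ | ⟨i, j, k, -, hjk, h₁, h₂, h⟩) |
    ⟨j, k, i, hjk, -, h₁, h₂, h⟩ | ⟨j, k, i, hjk, -, h₁, h₂, h⟩
  · exact .inl ⟨j, k, hjk, h₁.trans h₂, h⟩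
  · exact .inr ⟨j, k, hjk, h₁.trans h₂, h⟩
  · exact .inl ⟨j, k, hjk, h₁.trans h₂, h⟩
  · exact .inr ⟨j, k, hjk, h₁.trans h₂, h⟩

theorem card_starts_mul_swap (π : Equiv.Perm (Fin n)) {j k : Fin n} (hjk : (k : ℕ) = j + 1)
    (hlt : π j < π k) (hK : KnuthMove π (π * Equiv.swap j k)) :
    (KnuthBoth π (π * Equiv.swap j k) →
      (starts 0 (ofPerm π)).card = (starts 0 (ofPerm (π * Equiv.swap j k))).card + 1) ∧
    (¬ KnuthBoth π (π * Equiv.swap j k) →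
      (starts 0 (ofPerm π)).card = (starts 0 (ofPerm (π * Equiv.swap j k))).card) := by
  classical
  have h := card_starts_swap (p := j) (ofPerm_apply π j) (by rw [ofPerm_apply, hjk]) hlt
    (ofPerm_mul_swap π hjk)
  simp only [← knuthOne_mul_swap_iff π hjk hlt, ← knuthTwo_mul_swap_iff π hjk hlt] at h
  rw [KnuthMove] at hK
  rw [KnuthBoth]
  by_cases h₁ : KnuthOne π (π * Equiv.swap j k) <;> by_cases h₂ : KnuthTwo π (π * Equiv.swap j k)
    <;> simp_all

theorem KnuthMove.adjacentSwap {π w : Equiv.Perm (Fin n)} (h : KnuthMove π w) :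
    AdjacentSwap (ofPerm π) (ofPerm w) := by
  obtain ⟨j, k, hjk, -, rfl⟩ | ⟨j, k, hjk, -, rfl⟩ := h.exists_swap
  · exact ⟨j, ofPerm_mul_swap π hjk⟩
  · exact AdjacentSwap.symm ⟨j, ofPerm_mul_swap w hjk⟩

theorem KnuthMove.symm {π w : Equiv.Perm (Fin n)} (h : KnuthMove π w) : KnuthMove w π :=
  h.imp KnuthOne.symm KnuthTwo.symm

theorem KnuthMove.card_starts_eq {π w : Equiv.Perm (Fin n)} (h : KnuthMove π w)
    (hB : ¬ KnuthBoth π w) : (starts 0 (ofPerm π)).card = (starts 0 (ofPerm w)).card := by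
  obtain ⟨j, k, hjk, hlt, rfl⟩ | ⟨j, k, hjk, hlt, rfl⟩ := h.exists_swap
  · exact (card_starts_mul_swap π hjk hlt h).2 hB
  · exact ((card_starts_mul_swap w hjk hlt h.symm).2 (knuthBoth_comm.not.1 hB)).symm

theorem KnuthBoth.card_starts {π w : Equiv.Perm (Fin n)} (h : KnuthBoth π w) :
    (starts 0 (ofPerm π)).card = (starts 0 (ofPerm w)).card + 1 ∨
      (starts 0 (ofPerm w)).card = (starts 0 (ofPerm π)).card + 1 := by
  have hK : KnuthMove π w := .inl h.1
  obtain ⟨j, k, hjk, hlt, rfl⟩ | ⟨j, k, hjk, hlt, rfl⟩ := hK.exists_swap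
  · exact .inl ((card_starts_mul_swap π hjk hlt hK).1 h)
  · exact .inr ((card_starts_mul_swap w hjk hlt hK.symm).1 (knuthBoth_comm.1 h))

theorem KnuthPath.even_card_starts_add {π w : Equiv.Perm (Fin n)} {m : ℕ} (h : KnuthPath π w m) :
    Even ((starts 0 (ofPerm π)).card + (starts 0 (ofPerm w)).card + m) := by
  induction h with
  | refl => simp
  | both _ hB ih =>
    rw [Nat.even_iff] at ih ⊢
    have := hB.card_starts
    omega
  | proper _ hK hB ih =>
    rwa [← hK.card_starts_eq hB]

/-! ### The soliton decomposition -/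

theorem exists_isSteady (s : State n) : ∃ t, IsSteady (move^[t] s) := by
  obtain ⟨T, L, hsorted, -, hL⟩ := exists_runs_forall_ge s
  refine ⟨T, fun t => ?_, by rwa [(hL T le_rfl).1]⟩
  rw [← Function.iterate_add_apply, (hL (t + T) (by omega)).1, (hL T le_rfl).1]

theorem reachesSteadyState (w : Equiv.Perm (Fin n)) : ReachesSteadyState w :=
  exists_isSteady _

theorem length_SD (w : Equiv.Perm (Fin n)) : (SD w).length = (starts 0 (ofPerm w)).card := by
  obtain ⟨t, ht⟩ := reachesSteadyState w
  rw [SD_eq w t ht, List.length_reverse, length_runs, card_starts_iterate_move]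

theorem SD_eq_reverse {w : Equiv.Perm (Fin n)} {T : ℕ} {L : List (List (Fin n))}
    (hsorted : (L.map List.length).Pairwise (· ≤ ·))
    (hL : ∀ t ≥ T, runs (move^[t] (ofPerm w)) = L) : SD w = L.reverse := by
  rw [SD_eq w T, hL T le_rfl]
  refine ⟨fun t => ?_, by rwa [hL T le_rfl]⟩
  rw [← Function.iterate_add_apply, hL (t + T) (by omega), hL T le_rfl]

/-- If `m b` is the length of the list in `L` that contains `b`, then the number of `b` with
`m b = k` is `k` times the number of lists of length `k`. -/
theorem countP_flatten_eq {α : Type*} (m : α → ℕ) (k : ℕ) : ∀ {L : List (List α)},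
    (∀ l ∈ L, ∀ b ∈ l, m b = l.length) →
    L.flatten.countP (fun b => decide (m b = k)) = k * (L.map List.length).count k
  | [], _ => by simp
  | l :: L, h => by
    rw [List.forall_mem_cons] at h
    rw [List.flatten_cons, List.countP_append, countP_flatten_eq m k h.2, List.map_cons,
      List.count_cons]
    by_cases hk : l.length = k
    · have : l.countP (fun b => decide (m b = k)) = l.length :=
        List.countP_eq_length.2 fun b hb => by simp [h.1 b hb, hk]
      rw [this]
      simp [hk]
      ring
    · have : l.countP (fun b => decide (m b = k)) = 0 :=
        List.countP_eq_zero.2 fun b hb => by simp [h.1 b hb, hk]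
      rw [this]
      simp [hk]

theorem map_length_eq_of_speed {L L' : List (List (Fin n))} {m : Fin n → ℕ}
    (hperm : L.flatten.Perm (List.finRange n)) (hperm' : L'.flatten.Perm (List.finRange n))
    (hnil : [] ∉ L) (hnil' : [] ∉ L') (hsorted : (L.map List.length).Pairwise (· ≤ ·))
    (hsorted' : (L'.map List.length).Pairwise (· ≤ ·)) (hm : ∀ l ∈ L, ∀ b ∈ l, m b = l.length)
    (hm' : ∀ l ∈ L', ∀ b ∈ l, m b = l.length) : L.map List.length = L'.map List.length := by
  refine List.Perm.eq_of_pairwise (fun a b _ _ => le_antisymm) hsorted hsorted' ?_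
  rw [List.perm_iff_count]
  intro k
  -- Counting balls of speed `k` says nothing about `k = 0`; there the absence of empty lists is
  -- needed.
  rcases Nat.eq_zero_or_pos k with rfl | hk
  · rw [List.count_eq_zero.2 (by simpa using hnil), List.count_eq_zero.2 (by simpa using hnil')]
  · refine Nat.eq_of_mul_eq_mul_left hk ?_
    rw [← countP_flatten_eq m k hm, ← countP_flatten_eq m k hm',
      (hperm.trans hperm'.symm).countP_eq]

theorem eq_of_linear_of_le_add_one {a b m m' : ℕ} (h : ∀ j, a + j * m ≤ b + j * m' + 1)
    (h' : ∀ j, b + j * m' ≤ a + j * m + 1) : m = m' := by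
  -- Different slopes gain at least one per step, so after `a + b + 2` steps the initial gap is made
  -- up and exceeded by more than 1.
  have h₁ := h (a + b + 2)
  have h₂ := h' (a + b + 2)
  rcases lt_trichotomy m m' with hlt | heq | hlt
  · have := Nat.mul_le_mul_left (a + b + 2) hlt
    rw [Nat.succ_eq_add_one, mul_add] at this
    omega
  · exact heq
  · have := Nat.mul_le_mul_left (a + b + 2) hlt
    rw [Nat.succ_eq_add_one, mul_add] at this
    omega

/-- If the states of two systems always differ by an exchange of two adjacent boxes, then every
ball has the same speed in both, so that the solitons have the same sizes. -/
theorem shape_SD_eq_of_adjacentSwap {π w : Equiv.Perm (Fin n)}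
    (h : ∀ t, AdjacentSwap (move^[t] (ofPerm π)) (move^[t] (ofPerm w))) :
    shape (SD π) = shape (SD w) := by
  obtain ⟨T, L, hsorted, ⟨hperm, hnil⟩, hL⟩ := exists_runs_forall_ge (ofPerm π)
  obtain ⟨T', L', hsorted', ⟨hperm', hnil'⟩, hL'⟩ := exists_runs_forall_ge (ofPerm w)
  rw [SD_eq_reverse hsorted fun t ht => (hL t ht).1, SD_eq_reverse hsorted' fun t ht => (hL' t ht).1,
    shape, shape, List.map_reverse, List.map_reverse]
  congr 1
  set S := T + T'
  have hlin : ∀ l ∈ L, ∀ b ∈ l, ∀ j,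
      move^[S + j] (ofPerm π) b = move^[S] (ofPerm π) b + j * l.length := by
    intro l hl b hb j
    induction j with
    | zero => simp
    | succ j ih => rw [← add_assoc, (hL (S + j) (by omega)).2 l hl b hb, ih]; ring
  have hlin' : ∀ l ∈ L', ∀ b ∈ l, ∀ j,
      move^[S + j] (ofPerm w) b = move^[S] (ofPerm w) b + j * l.length := by
    intro l hl b hb j
    induction j with
    | zero => simp
    | succ j ih => rw [← add_assoc, (hL' (S + j) (by omega)).2 l hl b hb, ih]; ring
  refine map_length_eq_of_speed
    -- The common speed is read off in the system of `π`; by `hlin` the difference is the size of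
    -- the soliton, without truncation.
    (m := fun b => move^[S + 1] (ofPerm π) b - move^[S] (ofPerm π) b)
    hperm hperm' hnil hnil' hsorted hsorted' (fun l hl b hb => ?_) fun l' hl' b hb' => ?_
  · rw [hlin l hl b hb 1]; omega
  · obtain ⟨l, hl, hb⟩ := List.mem_flatten.1 (hperm.mem_iff.2 (List.mem_finRange b))
    rw [hlin l hl b hb 1, one_mul, Nat.add_sub_cancel_left]
    refine eq_of_linear_of_le_add_one (a := move^[S] (ofPerm π) b) (b := move^[S] (ofPerm w) b)
      (fun j => ?_) fun j => ?_
    · rw [← hlin l hl b hb, ← hlin' l' hl' b hb']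
      exact ((h (S + j)).le_add_one b).1
    · rw [← hlin l hl b hb, ← hlin' l' hl' b hb']
      exact ((h (S + j)).le_add_one b).2

theorem KnuthMove.shape_SD_eq {π w : Equiv.Perm (Fin n)} (h : KnuthMove π w)
    (hB : ¬ KnuthBoth π w) : shape (SD π) = shape (SD w) :=
  shape_SD_eq_of_adjacentSwap fun t => h.adjacentSwap.iterate_move (h.card_starts_eq hB) t

theorem KnuthPath.SD_ne {π w : Equiv.Perm (Fin n)} {m : ℕ} (h : KnuthPath π w m) (hm : Odd m) :
    SD π ≠ SD w := by
  intro heq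
  have := h.even_card_starts_add
  rw [← length_SD, ← length_SD, heq] at this
  rw [Nat.even_iff] at this
  rw [Nat.odd_iff] at hm
  omega

end BoxBall

theorem theorem7p1 {n : ℕ} (π w : Equiv.Perm (Fin n)) :
    (BoxBall.ReachesSteadyState π ∧ BoxBall.ReachesSteadyState w) ∧
    ((∃ m : ℕ, Odd m ∧ BoxBall.KnuthPath π w m) →
      BoxBall.SD π ≠ BoxBall.SD w) ∧
    (Relation.ReflTransGen
        (fun σ τ : Equiv.Perm (Fin n) => BoxBall.KnuthMove σ τ ∧ ¬ BoxBall.KnuthBoth σ τ) π w →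
      BoxBall.shape (BoxBall.SD π) = BoxBall.shape (BoxBall.SD w)) := by
  refine ⟨⟨BoxBall.reachesSteadyState π, BoxBall.reachesSteadyState w⟩,
    fun ⟨m, hm, h⟩ => h.SD_ne hm, fun h => ?_⟩
  induction h with
  | refl => rfl
  | tail _ h ih => exact ih.trans (h.1.shape_SD_eq h.2)
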